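/- A \emph{degree sensitive algorithm} is a deterministic adaptive priority algorithm $A$ (without resource constraints) of the following kind. The input is a graph $G$ on $n$ labelled nodes, and $A$ knows $n$ (and the set of labels) in advance. In each round, $A$ uses $n$ and the data items received in the previous rounds to compute a total priority order of all possible data items $\langle u,d_u,v\rangle$, where $u,v$ are nodes and $d_u\ge 1$ is an integer. It then receives the item of highest priority among those contained in the input, i.e. those such that $u$ and $v$ are adjacent in the current reduced graph (the graph $G$ without all edges incident with nodes matched in earlier rounds) and $u$ has degree $d_u$ in the reduced graph. On receiving $\langle u,d_u,v\rangle$, the algorithm must match $u$ with $v$. Rounds are played until the reduced graph has no edge. Theorem. Let $\Delta\ge 2$ be an integer. For each degree sensitive algorithm $A$ and each $\varepsilon>0$ there is a bipartite graph $G$ with maximum degree $\Delta$ and with a perfect matching such that the matching computed by $A$ on $G$ has size at most $\left(\frac{\Delta}{2\Delta-2}+\varepsilon\right)$ times the size of a maximum matching of $G$. -/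

import Mathlib

/-- A data item `⟨u, d_u, v⟩` for graphs on the `n` nodes `Fin n`. (An item with `deg = 0` or `u = v`
never occurs in an input, so its position in a priority order is irrelevant.) -/
@[ext]
structure DataItem (n : ℕ) where
  u : Fin n
  deg : ℕ
  v : Fin n

/-- The edge `{u, v}` of a data item. -/
def DataItem.edge {n : ℕ} (d : DataItem n) : Sym2 (Fin n) := s(d.u, d.v)

/-- A deterministic degree sensitive adaptive priority algorithm. It has no resource constraints.
From its a priori knowledge (the number `n` of nodes) and the information gathered so far (the list
of data items received in the previous rounds, oldest first) it computes a total order on all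
possible data items, the larger items having the higher priority. Its decision on a received item is
forced (`u` and `v` are matched with each other), so the orders are all that it chooses. -/
structure DegreeSensitiveAlgorithm where
  order : (n : ℕ) → List (DataItem n) → LinearOrder (DataItem n)

namespace DegreeSensitive

variable {n : ℕ}

/-- The nodes matched in the rounds in which the items of `h` were received. -/
def matched (h : List (DataItem n)) : Finset (Fin n) :=
  (h.map DataItem.u).toFinset ∪ (h.map DataItem.v).toFinset

/-- The reduced graph: matched nodes lose all their edges. -/
def reduced (G : SimpleGraph (Fin n)) (h : List (DataItem n)) : SimpleGraph (Fin n) where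
  Adj a b := G.Adj a b ∧ a ∉ matched h ∧ b ∉ matched h
  symm := ⟨fun _ _ hab => ⟨hab.1.symm, hab.2.2, hab.2.1⟩⟩
  loopless := ⟨fun _ haa => haa.1.ne rfl⟩

open Classical in
/-- The data items contained in the reduced input: all `⟨u, d_u, v⟩` such that `u` and `v` are
neighbors in the reduced graph and `d_u` is the degree of `u` in the reduced graph. -/
noncomputable def items (G : SimpleGraph (Fin n)) (h : List (DataItem n)) :
    Finset (DataItem n) :=
  (Finset.univ.filter fun p : Fin n × Fin n => (reduced G h).Adj p.1 p.2).image
    fun p => ⟨p.1, ((reduced G h).neighborSet p.1).ncard, p.2⟩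

/-- The data item received after the items in `h`: the one of highest priority in the reduced
input. -/
noncomputable def received (A : DegreeSensitiveAlgorithm) (G : SimpleGraph (Fin n))
    (h : List (DataItem n)) (hne : (items G h).Nonempty) : DataItem n :=
  @Finset.max' _ (A.order n h) (items G h) hne

theorem mem_items {G : SimpleGraph (Fin n)} {h : List (DataItem n)} {d : DataItem n} :
    d ∈ items G h ↔
      (reduced G h).Adj d.u d.v ∧ d.deg = ((reduced G h).neighborSet d.u).ncard := by
  simp only [items, Finset.mem_image, Finset.mem_filter, Finset.mem_univ, true_and]
  constructor
  · rintro ⟨p, hp, rfl⟩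
    exact ⟨hp, rfl⟩
  · rintro ⟨h1, h2⟩
    exact ⟨(d.u, d.v), h1, DataItem.ext rfl h2.symm rfl⟩

theorem received_mem (A : DegreeSensitiveAlgorithm) (G : SimpleGraph (Fin n))
    (h : List (DataItem n)) (hne : (items G h).Nonempty) :
    received A G h hne ∈ items G h :=
  @Finset.max'_mem _ (A.order n h) (items G h) hne

theorem card_unmatched_lt (A : DegreeSensitiveAlgorithm) (G : SimpleGraph (Fin n))
    (h : List (DataItem n)) (hne : (items G h).Nonempty) :
    (matched (h ++ [received A G h hne]))ᶜ.card < (matched h)ᶜ.card := by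
  have hu := (mem_items.1 (received_mem A G h hne)).1.2.1
  refine Finset.card_lt_card ⟨?_, fun hsub => ?_⟩
  · intro x
    simp only [matched, Finset.mem_compl, Finset.mem_union, List.mem_toFinset, List.map_append,
      List.mem_append]
    tauto
  · have := hsub (Finset.mem_compl.2 hu)
    simp [matched] at this

/-- The sequence of all data items received by `A` on input `G`, given that the items in `h` were
received first: rounds are played until no data item is left. -/
noncomputable def runFrom (A : DegreeSensitiveAlgorithm) (G : SimpleGraph (Fin n))
    (h : List (DataItem n)) : List (DataItem n) :=
  open Classical in
  if hne : (items G h).Nonempty then runFrom A G (h ++ [received A G h hne]) else h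
termination_by (matched h)ᶜ.card
decreasing_by exact card_unmatched_lt A G h hne

/-- The matching computed by `A` on input `G`, as a set of edges. -/
noncomputable def output (A : DegreeSensitiveAlgorithm) (G : SimpleGraph (Fin n)) :
    Finset (Sym2 (Fin n)) :=
  ((runFrom A G []).map DataItem.edge).toFinset

/-- The size of a maximum matching of `G`. -/
noncomputable def optimum (G : SimpleGraph (Fin n)) : ℕ :=
  sSup {k | ∃ M : G.Subgraph, M.IsMatching ∧ M.edgeSet.ncard = k}

end DegreeSensitive

/-! Let `C` be a node cover containing exactly one end of each edge of a perfect matching, so that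
|C| is at most the optimum. Every received edge uses up a node of `C`, and an edge inside `C` uses
up two. Hence the output has at most |C| edges minus the number of edges received inside `C`
(`exists_card_output_le_of_forces`). An adversary who fixes the graph only during the run forces
many such edges.

Unmatched nodes can still be relabelled freely, so in each round the algorithm really chooses only a
degree, and the adversary may answer with any edge at a node of that degree
(`Forces.exists_isRunPrefix`).

In the trap graph `C` consists of gates and hubs, and the leaves are their partners. Gates are
joined in pairs across two sides, and the pairs have a fixed order. In each pair some gate can be
given any degree from 2 to Δ at the moment this degree is asked for, so such a request always yields
the next gate pair, an edge inside `C`. Degree 1 occurs only in clusters whose last gate is already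
matched, because all live nodes keep degree at least 2; an answer there does not disturb the plan
(`forces_of_isPosition`).

With T clusters per side, ℓ gates and κ hubs in each, Tℓ - 1 of 2T(ℓ + κ) edges are lost. For ℓ =
κ(Δ - 2) the remaining fraction tends to (ℓ + 2κ)/(2ℓ + 2κ) = Δ/(2Δ - 2) as T grows. For Δ = 2 this
ratio is 1 and any example will do. -/

namespace DegreeSensitive

/-! ### Runs and the covering bound on the output -/

section Run

variable {n : ℕ} {A : DegreeSensitiveAlgorithm} {G : SimpleGraph (Fin n)}

/-- `h` is an initial segment of the sequence of items that `A` receives on `G`. -/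
inductive IsRunPrefix (A : DegreeSensitiveAlgorithm) (G : SimpleGraph (Fin n)) :
    List (DataItem n) → Prop
  | nil : IsRunPrefix A G []
  | snoc (h : List (DataItem n)) (hne : (items G h).Nonempty) :
      IsRunPrefix A G h → IsRunPrefix A G (h ++ [received A G h hne])

theorem runFrom_of_nonempty {h : List (DataItem n)} (hne : (items G h).Nonempty) :
    runFrom A G h = runFrom A G (h ++ [received A G h hne]) := by
  rw [runFrom, dif_pos hne]

theorem IsRunPrefix.runFrom_eq {h : List (DataItem n)} (hh : IsRunPrefix A G h) :
    runFrom A G [] = runFrom A G h := by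
  induction hh with
  | nil => rfl
  | snoc h hne _ ih => rw [ih, runFrom_of_nonempty hne]

theorem IsRunPrefix.runFrom {h : List (DataItem n)} (hh : IsRunPrefix A G h) :
    IsRunPrefix A G (runFrom A G h) ∧ h <+: runFrom A G h := by
  by_cases hne : (items G h).Nonempty
  · rw [runFrom_of_nonempty hne]
    have := IsRunPrefix.runFrom (IsRunPrefix.snoc h hne hh)
    exact ⟨this.1, (List.prefix_append _ _).trans this.2⟩
  · rw [DegreeSensitive.runFrom, dif_neg hne]
    exact ⟨hh, List.prefix_rfl⟩
termination_by (matched h)ᶜ.card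
decreasing_by exact card_unmatched_lt A G h hne

theorem matched_append_singleton (h : List (DataItem n)) (d : DataItem n) :
    matched (h ++ [d]) = insert d.u (insert d.v (matched h)) := by
  ext x
  simp only [matched, List.map_append, List.mem_toFinset, List.mem_append, Finset.mem_union,
    Finset.mem_insert, List.map_cons, List.map_nil, List.mem_singleton]
  tauto

/-- Both ends of a newly received edge are unmatched so far, so each round adds one new node of `C`,
or two if the edge lies inside `C`. -/
theorem IsRunPrefix.length_add_countP_le {C : Finset (Fin n)}
    (hC : ∀ a b, G.Adj a b → a ∈ C ∨ b ∈ C) {h : List (DataItem n)} (hh : IsRunPrefix A G h) :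
    h.length + h.countP (fun d => d.u ∈ C ∧ d.v ∈ C) ≤ (matched h ∩ C).card := by
  induction hh with
  | nil => simp
  | snoc h hne _ ih =>
    set d := received A G h hne
    obtain ⟨hadj, hu, hv⟩ := (mem_items.1 (received_mem A G h hne)).1
    have huv : d.u ≠ d.v := hadj.ne
    rw [matched_append_singleton, List.length_append, List.countP_append]
    by_cases hdu : d.u ∈ C <;> by_cases hdv : d.v ∈ C
    · rw [Finset.insert_inter_of_mem hdu, Finset.insert_inter_of_mem hdv,
        Finset.card_insert_of_notMem (by simp [huv, d, hu]),
        Finset.card_insert_of_notMem (by simp [d, hv])]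
      simp [hdu, hdv] at ih ⊢; omega
    · rw [Finset.insert_inter_of_mem hdu, Finset.insert_inter_of_notMem hdv,
        Finset.card_insert_of_notMem (by simp [d, hu])]
      simp [hdu, hdv] at ih ⊢; omega
    · rw [Finset.insert_inter_of_notMem hdu, Finset.insert_inter_of_mem hdv,
        Finset.card_insert_of_notMem (by simp [d, hv])]
      simp [hdu, hdv] at ih ⊢; omega
    · exact absurd (hC _ _ hadj) (by tauto)

theorem IsRunPrefix.card_output_add_countP_le {C : Finset (Fin n)}
    (hC : ∀ a b, G.Adj a b → a ∈ C ∨ b ∈ C) {h : List (DataItem n)} (hh : IsRunPrefix A G h) :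
    (output A G).card + h.countP (fun d => d.u ∈ C ∧ d.v ∈ C) ≤ C.card := by
  obtain ⟨h1, h2⟩ := hh.runFrom
  have h3 := h1.length_add_countP_le hC
  have h4 := h2.sublist.countP_le (p := fun d : DataItem n => decide (d.u ∈ C ∧ d.v ∈ C))
  have h5 : (output A G).card ≤ (DegreeSensitive.runFrom A G h).length := by
    rw [output, hh.runFrom_eq]
    exact (List.toFinset_card_le _).trans (by simp)
  have h6 := Finset.card_le_card (Finset.inter_subset_right (s₁ := matched
    (DegreeSensitive.runFrom A G h)) (s₂ := C))
  omega

theorem ncard_edgeSet_le_optimum {M : G.Subgraph} (hM : M.IsMatching) :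
    M.edgeSet.ncard ≤ optimum G :=
  le_csSup ⟨Nat.card (Sym2 (Fin n)), by
    rintro k ⟨M, -, rfl⟩
    exact Set.ncard_le_card _⟩ ⟨M, hM, rfl⟩

end Run

/-! ### The adversary game and its reduction to a choice of degrees -/

section Labelling

variable {V : Type*} {n : ℕ}

/-- The copy of `G` in which the node `x` has the label `σ x`. -/
def labelled (G : SimpleGraph V) (σ : V ≃ Fin n) : SimpleGraph (Fin n) := G.comap σ.symm

theorem labelled_adj {G : SimpleGraph V} {σ : V ≃ Fin n} {x y : V} :
    (labelled G σ).Adj (σ x) (σ y) ↔ G.Adj x y := by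
  simp [labelled]

/-- The nodes that occur in a list of pairs. -/
def touched (m : List (V × V)) : Set V := {x | ∃ p ∈ m, x = p.1 ∨ x = p.2}

theorem touched_append_singleton (m : List (V × V)) (p : V × V) :
    touched (m ++ [p]) = insert p.1 (insert p.2 (touched m)) := by
  ext x
  simp only [touched, Set.mem_ofPred_eq, List.mem_append, List.mem_singleton, Set.mem_insert_iff]
  constructor
  · rintro ⟨q, hq | rfl, h⟩
    · exact Or.inr (Or.inr ⟨q, hq, h⟩)
    · tauto
  · rintro (h | h | ⟨q, hq, h⟩)
    · exact ⟨p, Or.inr rfl, Or.inl h⟩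
    · exact ⟨p, Or.inr rfl, Or.inr h⟩
    · exact ⟨q, Or.inl hq, h⟩

/-- The graph `G` without the edges that meet a pair in `m`. -/
def residual (G : SimpleGraph V) (m : List (V × V)) : SimpleGraph V where
  Adj a b := G.Adj a b ∧ a ∉ touched m ∧ b ∉ touched m
  symm := ⟨fun _ _ hab => ⟨hab.1.symm, hab.2.2, hab.2.1⟩⟩
  loopless := ⟨fun _ haa => haa.1.ne rfl⟩

/-- The pairs of nodes in `h` are those in `m`, labelled by `σ`. -/
def Labels (σ : V ≃ Fin n) (m : List (V × V)) (h : List (DataItem n)) : Prop :=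
  h.map (fun d => (d.u, d.v)) = m.map (Prod.map σ σ)

theorem Labels.mem_matched {σ : V ≃ Fin n} {m : List (V × V)} {h : List (DataItem n)}
    (hL : Labels σ m h) (x : V) : σ x ∈ matched h ↔ x ∈ touched m := by
  have hu : h.map DataItem.u = m.map fun p => σ p.1 := by
    have := congrArg (List.map Prod.fst) hL
    simpa [Function.comp_def] using this
  have hv : h.map DataItem.v = m.map fun p => σ p.2 := by
    have := congrArg (List.map Prod.snd) hL
    simpa [Function.comp_def] using this
  simp only [matched, hu, hv, touched, Finset.mem_union, List.mem_toFinset, List.mem_map,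
    EmbeddingLike.apply_eq_iff_eq, Set.mem_ofPred_eq]
  constructor
  · rintro (⟨p, hp, h⟩ | ⟨p, hp, h⟩)
    · exact ⟨p, hp, Or.inl h.symm⟩
    · exact ⟨p, hp, Or.inr h.symm⟩
  · rintro ⟨p, hp, h | h⟩
    · exact Or.inl ⟨p, hp, h.symm⟩
    · exact Or.inr ⟨p, hp, h.symm⟩

theorem Labels.reduced_adj {σ : V ≃ Fin n} {m : List (V × V)} {h : List (DataItem n)}
    (hL : Labels σ m h) (G : SimpleGraph V) (x y : V) :
    (reduced (labelled G σ) h).Adj (σ x) (σ y) ↔ (residual G m).Adj x y := by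
  simp only [reduced, residual, labelled_adj, hL.mem_matched]

theorem Labels.ncard_neighborSet {σ : V ≃ Fin n} {m : List (V × V)} {h : List (DataItem n)}
    (hL : Labels σ m h) (G : SimpleGraph V) (x : V) :
    ((reduced (labelled G σ) h).neighborSet (σ x)).ncard =
      ((residual G m).neighborSet x).ncard := by
  rw [← Set.ncard_image_of_injective _ σ.injective]
  congr 1
  ext a
  obtain ⟨y, rfl⟩ := σ.surjective a
  simp [hL.reduced_adj]

/-- `Forces Goal F m`: after the moves `m` have been played, an adversary who is still free to choose
the graph from the family `F` reaches the goal against every choice of degrees. In each round an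
opponent picks a degree from a set that contains all degrees of the reduced graph, and the adversary
answers with an edge at a node of that degree, thereby restricting the family. -/
inductive Forces (Goal : List (V × V) → Prop) : Set (SimpleGraph V) → List (V × V) → Prop
  | done {F : Set (SimpleGraph V)} {m : List (V × V)} (G : SimpleGraph V) :
      G ∈ F → Goal m → Forces Goal F m
  | round {F : Set (SimpleGraph V)} {m : List (V × V)} (S : Finset ℕ) (hS : S.Nonempty)
      (x y : ℕ → V) (F' : ℕ → Set (SimpleGraph V)) :
      (∀ G ∈ F, ∀ x y, (residual G m).Adj x y → ((residual G m).neighborSet x).ncard ∈ S) →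
      (∀ d ∈ S, F' d ⊆ F) →
      (∀ d ∈ S, ∀ G ∈ F' d, (residual G m).Adj (x d) (y d) ∧
        ((residual G m).neighborSet (x d)).ncard = d) →
      (∀ d ∈ S, Forces Goal (F' d) (m ++ [(x d, y d)])) → Forces Goal F m

theorem Forces.nonempty {Goal : List (V × V) → Prop} {F : Set (SimpleGraph V)} {m : List (V × V)}
    (hF : Forces Goal F m) : F.Nonempty := by
  induction hF with
  | done G hG _ => exact ⟨G, hG⟩
  | round S hS x y F' _ hsub _ _ ih =>
    obtain ⟨d, hd⟩ := hS
    exact (ih d hd).mono (hsub d hd)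

/-- Two transpositions do it, one bringing `x` to `a` and then one bringing `y` to `b`. All the
nodes they move lie outside `X`. -/
theorem exists_relabelling (σ : V ≃ Fin n) (X : Set V) {x y : V} {a b : Fin n} (hxy : x ≠ y)
    (hab : a ≠ b) (hx : x ∉ X) (hy : y ∉ X) (ha : σ.symm a ∉ X) (hb : σ.symm b ∉ X) :
    ∃ τ : V ≃ Fin n, τ x = a ∧ τ y = b ∧ ∀ z ∈ X, τ z = σ z := by
  classical
  set σ₁ := (Equiv.swap x (σ.symm a)).trans σ with hσ₁
  have h1x : σ₁ x = a := by simp [hσ₁]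
  have h1 : ∀ z ∈ X, σ₁ z = σ z := fun z hz => by
    simp only [hσ₁, Equiv.trans_apply]
    rw [Equiv.swap_apply_of_ne_of_ne] <;> rintro rfl <;> contradiction
  have h1b : σ₁.symm b ∉ X := fun h => hb (by
    have := h1 _ h
    rw [Equiv.apply_symm_apply] at this
    rw [this, Equiv.symm_apply_apply]; exact h)
  refine ⟨(Equiv.swap y (σ₁.symm b)).trans σ₁, ?_, by simp, fun z hz => ?_⟩
  · simp only [Equiv.trans_apply]
    rw [Equiv.swap_apply_of_ne_of_ne hxy, h1x]
    rintro h
    exact hab (by rw [← h1x, h, Equiv.apply_symm_apply])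
  · simp only [Equiv.trans_apply]
    rw [Equiv.swap_apply_of_ne_of_ne, h1 z hz] <;> rintro rfl <;> contradiction

/-- The set `P` need not depend on the graph, so the next item can be fixed while graph and
labelling are still open. -/
theorem received_eq_of_isMax {A : DegreeSensitiveAlgorithm} {G : SimpleGraph (Fin n)}
    {h : List (DataItem n)} {P : Set (DataItem n)} {d : DataItem n}
    (hsub : ∀ e ∈ items G h, e ∈ P) (hmax : ∀ e ∈ P, (A.order n h).le e d) (hd : d ∈ items G h) :
    received A G h ⟨d, hd⟩ = d := by
  let _ := A.order n h
  exact le_antisymm (hmax _ (hsub _ (received_mem A G h ⟨d, hd⟩)))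
    (Finset.le_max' (items G h) d hd)

theorem Labels.exists_eq_of_mem_items {σ : V ≃ Fin n} {m : List (V × V)} {h : List (DataItem n)}
    (hL : Labels σ m h) {G : SimpleGraph V} {e : DataItem n} (he : e ∈ items (labelled G σ) h) :
    ∃ x y, e = ⟨σ x, ((residual G m).neighborSet x).ncard, σ y⟩ ∧ (residual G m).Adj x y := by
  obtain ⟨h1, h2⟩ := mem_items.1 he
  refine ⟨σ.symm e.u, σ.symm e.v, ?_, ?_⟩
  · ext1
    · simp
    · rw [h2, ← hL.ncard_neighborSet, Equiv.apply_symm_apply]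
    · simp
  · rw [← hL.reduced_adj]
    simpa using h1

theorem Labels.congr {σ σ' : V ≃ Fin n} {m : List (V × V)} {h : List (DataItem n)}
    (hL : Labels σ m h) (hσ : ∀ z ∈ touched m, σ' z = σ z) : Labels σ' m h := by
  refine Eq.trans hL (List.map_congr_left fun p hp => ?_)
  ext1
  · exact (hσ _ ⟨p, hp, Or.inl rfl⟩).symm
  · exact (hσ _ ⟨p, hp, Or.inr rfl⟩).symm

theorem Labels.snoc {σ : V ≃ Fin n} {m : List (V × V)} {h : List (DataItem n)}
    (hL : Labels σ m h) {x y : V} {e : DataItem n} (hu : e.u = σ x) (hv : e.v = σ y) :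
    Labels σ (m ++ [(x, y)]) (h ++ [e]) := by
  simp only [Labels, List.map_append] at hL ⊢
  rw [hL]
  simp [hu, hv]

/-- The induction carries `hrun`: the run so far is the same for all graphs left in the family and
all labellings that agree on the touched nodes, so both may still be changed elsewhere. -/
theorem Forces.exists_isRunPrefix (A : DegreeSensitiveAlgorithm) {Goal : List (V × V) → Prop}
    {F : Set (SimpleGraph V)} {m : List (V × V)} (hF : Forces Goal F m) (σ : V ≃ Fin n)
    (h : List (DataItem n)) (hL : Labels σ m h)
    (hrun : ∀ G ∈ F, ∀ σ' : V ≃ Fin n, (∀ z ∈ touched m, σ' z = σ z) →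
      IsRunPrefix A (labelled G σ') h) :
    ∃ G ∈ F, ∃ (τ : V ≃ Fin n) (m' : List (V × V)) (h' : List (DataItem n)),
      Goal m' ∧ Labels τ m' h' ∧ IsRunPrefix A (labelled G τ) h' := by
  induction hF generalizing σ h with
  | done G hG hgoal => exact ⟨G, hG, σ, _, h, hgoal, hL, hrun G hG σ fun _ _ => rfl⟩
  | @round F m S hS x y F' hdeg hsub hans hforces ih =>
    classical
    -- `P` contains every item that any remaining input can contain. Its item of highest priority
    -- prescribes two labels and a degree; the adversary takes the answer to this degree and gives
    -- its ends these labels.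
    let P : Finset (DataItem n) :=
      ((Finset.univ.filter fun p : Fin n × Fin n =>
        p.1 ≠ p.2 ∧ p.1 ∉ matched h ∧ p.2 ∉ matched h) ×ˢ S).image
        fun q => ⟨q.1.1, q.2, q.1.2⟩
    have hP : ∀ e : DataItem n,
        e ∈ P ↔ (e.u ≠ e.v ∧ e.u ∉ matched h ∧ e.v ∉ matched h) ∧ e.deg ∈ S := by
      intro e
      simp only [P, Finset.mem_image, Finset.mem_product, Finset.mem_filter, Finset.mem_univ,
        true_and]
      constructor
      · rintro ⟨q, hq, rfl⟩
        exact hq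
      · intro he
        exact ⟨((e.u, e.v), e.deg), he, rfl⟩
    have hitems : ∀ G ∈ F, ∀ σ' : V ≃ Fin n, (∀ z ∈ touched m, σ' z = σ z) →
        ∀ e ∈ items (labelled G σ') h, e ∈ (P : Set (DataItem n)) := by
      intro G hG σ' hσ' e he
      have hL' := hL.congr hσ'
      obtain ⟨a, b, rfl, hab⟩ := hL'.exists_eq_of_mem_items he
      rw [Finset.mem_coe, hP]
      refine ⟨⟨?_, ?_, ?_⟩, hdeg G hG a b hab⟩
      · simpa using hab.ne
      · simpa [hL'.mem_matched] using hab.2.1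
      · simpa [hL'.mem_matched] using hab.2.2
    have hmem : ∀ d ∈ S, ∀ G ∈ F' d, ∀ σ' : V ≃ Fin n, (∀ z ∈ touched m, σ' z = σ z) →
        (⟨σ' (x d), d, σ' (y d)⟩ : DataItem n) ∈ items (labelled G σ') h := by
      intro d hd G hG σ' hσ'
      have hL' := hL.congr hσ'
      rw [mem_items, hL'.reduced_adj, hL'.ncard_neighborSet]
      exact ⟨(hans d hd G hG).1, (hans d hd G hG).2.symm⟩
    have hne : P.Nonempty := by
      obtain ⟨d, hd⟩ := hS
      obtain ⟨G, hG⟩ := (hforces d hd).nonempty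
      exact ⟨_, hitems G (hsub d hd hG) σ (fun _ _ => rfl) _
        (hmem d hd G hG σ fun _ _ => rfl)⟩
    obtain ⟨e, heP, hmax⟩ : ∃ e ∈ P, ∀ e' ∈ P, (A.order n h).le e' e := by
      let _ := A.order n h
      exact ⟨P.max' hne, P.max'_mem hne, fun e' he' => P.le_max' e' he'⟩
    obtain ⟨⟨huv, hu, hv⟩, hd⟩ := (hP e).1 heP
    obtain ⟨G₀, hG₀⟩ := (hforces _ hd).nonempty
    obtain ⟨hadj, -⟩ := hans _ hd G₀ hG₀
    obtain ⟨τ, hτx, hτy, hτ⟩ := exists_relabelling σ (touched m) hadj.ne huv hadj.2.1 hadj.2.2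
      (by rwa [← hL.mem_matched, Equiv.apply_symm_apply])
      (by rwa [← hL.mem_matched, Equiv.apply_symm_apply])
    obtain ⟨G, hG, hrest⟩ := ih e.deg hd τ (h ++ [e])
      ((hL.congr hτ).snoc hτx.symm hτy.symm) (by
        intro G hG σ' hσ'
        rw [touched_append_singleton] at hσ'
        have hσ'' : ∀ z ∈ touched m, σ' z = σ z := fun z hz =>
          (hσ' z (Or.inr (Or.inr hz))).trans (hτ z hz)
        have he : (⟨σ' (x e.deg), e.deg, σ' (y e.deg)⟩ : DataItem n) = e := by
          ext1
          · exact (hσ' _ (Or.inl rfl)).trans hτx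
          · rfl
          · exact (hσ' _ (Or.inr (Or.inl rfl))).trans hτy
        have hei := hmem _ hd G hG σ' hσ''
        rw [he] at hei
        have hrec := received_eq_of_isMax (hitems G (hsub _ hd hG) σ' hσ'') hmax hei
        have := IsRunPrefix.snoc h ⟨e, hei⟩ (hrun G (hsub _ hd hG) σ' hσ'')
        rwa [hrec] at this)
    exact ⟨G, hsub _ hd hG, hrest⟩

end Labelling

/-! ### From forced edges inside a cover to a bound on the output -/

/-- The number of pairs in a list both components of which are in `C`. -/
def pairsIn {V : Type*} [DecidableEq V] (C : Finset V) (m : List (V × V)) : ℕ :=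
  m.countP fun p => p.1 ∈ C ∧ p.2 ∈ C

theorem pairsIn_append_singleton {V : Type*} [DecidableEq V] (C : Finset V) (m : List (V × V))
    (p : V × V) :
    pairsIn C (m ++ [p]) = pairsIn C m + if p.1 ∈ C ∧ p.2 ∈ C then 1 else 0 := by
  simp [pairsIn, List.countP_append, List.countP_singleton]

/-- If the adversary can force `r` edges with both end nodes in a node cover `C` that contains exactly
one end node of each edge of a perfect matching, then the algorithm loses `r` edges. -/
theorem exists_card_output_le_of_forces {V : Type*} [Fintype V] [DecidableEq V]
    (A : DegreeSensitiveAlgorithm) {Δ r : ℕ} (C : Finset V) (F : Set (SimpleGraph V)) (ι : V → V)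
    (colour : V → Bool) (hcover : ∀ G ∈ F, ∀ x y, G.Adj x y → x ∈ C ∨ y ∈ C)
    (hι : ∀ G ∈ F, ∀ x, G.Adj x (ι x)) (hιι : ∀ x, ι (ι x) = x) (hιC : ∀ x ∈ C, ι x ∉ C)
    (hcolour : ∀ G ∈ F, ∀ x y, G.Adj x y → colour x ≠ colour y)
    (hle : ∀ G ∈ F, ∀ x, (G.neighborSet x).ncard ≤ Δ)
    (heq : ∀ G ∈ F, ∃ x, (G.neighborSet x).ncard = Δ)
    (hF : Forces (fun m => r ≤ pairsIn C m) F []) :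
    ∃ (n : ℕ) (G : SimpleGraph (Fin n)), G.IsBipartite ∧ (∀ v, (G.neighborSet v).ncard ≤ Δ) ∧
      (∃ v, (G.neighborSet v).ncard = Δ) ∧ (∃ M : G.Subgraph, M.IsPerfectMatching) ∧
      (output A G).card + r ≤ C.card ∧ C.card ≤ optimum G := by
  obtain ⟨G, hG, σ, m, h, hgoal, hL, hrun⟩ := hF.exists_isRunPrefix A (Fintype.equivFin V) []
    rfl fun _ _ _ _ => IsRunPrefix.nil
  have hadj : ∀ a b, (labelled G σ).Adj a b ↔ G.Adj (σ.symm a) (σ.symm b) := fun _ _ => Iff.rfl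
  have hcard : ∀ a, ((labelled G σ).neighborSet a).ncard = (G.neighborSet (σ.symm a)).ncard := by
    intro a
    rw [← Set.ncard_image_of_injective _ σ.symm.injective]
    congr 1
    ext x
    simp [labelled]
  let M : (labelled G σ).Subgraph :=
    { verts := Set.univ
      Adj := fun a b => b = σ (ι (σ.symm a))
      adj_sub := by
        rintro a _ rfl
        rw [hadj, Equiv.symm_apply_apply]
        exact hι G hG _
      edge_vert := fun _ => Set.mem_univ _
      symm := ⟨by
        rintro a _ rfl
        simp [hιι]⟩ }
  have hM : M.IsPerfectMatching := by
    rw [SimpleGraph.Subgraph.isPerfectMatching_iff]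
    exact fun v => ⟨_, rfl, fun _ h => h⟩
  refine ⟨_, labelled G σ, ?_, fun v => (hcard v).trans_le (hle G hG _), ?_, ⟨M, hM⟩, ?_, ?_⟩
  · refine ⟨SimpleGraph.Coloring.mk (fun a => if colour (σ.symm a) then 0 else 1) ?_⟩
    intro a b hab
    have := hcolour G hG _ _ ((hadj a b).1 hab)
    revert this
    cases colour (σ.symm a) <;> cases colour (σ.symm b) <;> simp
  · obtain ⟨x, hx⟩ := heq G hG
    exact ⟨σ x, by rw [hcard, Equiv.symm_apply_apply, hx]⟩
  · have h1 := hrun.card_output_add_countP_le (C := C.map σ.toEmbedding) (by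
      intro a b hab
      simpa using hcover G hG _ _ ((hadj a b).1 hab))
    have h2 : h.countP (fun d => d.u ∈ C.map σ.toEmbedding ∧ d.v ∈ C.map σ.toEmbedding) =
        pairsIn C m := by
      have h3 := congrArg (List.countP fun p : Fin _ × Fin _ =>
        p.1 ∈ C.map σ.toEmbedding ∧ p.2 ∈ C.map σ.toEmbedding) hL
      rw [List.countP_map, List.countP_map] at h3
      simpa [pairsIn, Function.comp_def] using h3
    rw [Finset.card_map, h2] at h1
    exact (Nat.add_le_add_left hgoal _).trans h1
  · refine le_trans ?_ (ncard_edgeSet_le_optimum hM.1)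
    rw [← Set.ncard_coe_finset]
    -- Distinct nodes of `C` give distinct matching edges, since `ι` maps `C` outside `C`.
    refine Set.ncard_le_ncard_of_injOn (fun x => s(σ x, σ (ι x))) ?_ ?_ (Set.toFinite _)
    · intro x _
      rw [SimpleGraph.Subgraph.mem_edgeSet]
      simp [M]
    · intro x hx y hy hxy
      simp only [Sym2.eq_iff, EmbeddingLike.apply_eq_iff_eq] at hxy
      rcases hxy with h | h
      · exact h.1
      · exact absurd (h.1 ▸ hx) (hιC y hy)

/-! ### Maximum degree two -/

/-- The cycle of length four. -/
def fourCycle : SimpleGraph (Bool × Bool) where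
  Adj x y := x.1 ≠ y.1
  symm := ⟨fun _ _ h => h.symm⟩
  loopless := ⟨fun _ h => h rfl⟩

theorem ncard_neighborSet_fourCycle (x : Bool × Bool) : (fourCycle.neighborSet x).ncard = 2 := by
  have : fourCycle.neighborSet x = ({(!x.1, false), (!x.1, true)} : Set (Bool × Bool)) := by
    ext ⟨a, b⟩
    obtain ⟨c, d⟩ := x
    cases a <;> cases b <;> cases c <;> simp [fourCycle]
  rw [this, Set.ncard_pair (by simp)]

theorem exists_of_max_degree_two (A : DegreeSensitiveAlgorithm) :
    ∃ (n : ℕ) (G : SimpleGraph (Fin n)), G.IsBipartite ∧ (∀ v, (G.neighborSet v).ncard ≤ 2) ∧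
      (∃ v, (G.neighborSet v).ncard = 2) ∧ (∃ M : G.Subgraph, M.IsPerfectMatching) ∧
      (output A G).card + 0 ≤ 2 ∧ 2 ≤ optimum G := by
  refine exists_card_output_le_of_forces A (Finset.univ.filter fun x : Bool × Bool => x.1)
    {fourCycle} (fun x => (!x.1, x.2)) Prod.fst ?_ ?_ ?_ ?_ ?_ ?_ ?_
    (Forces.done fourCycle rfl (Nat.zero_le _))
  · rintro _ rfl x y h
    revert h
    simp only [fourCycle, Finset.mem_filter, Finset.mem_univ, true_and]
    cases x.1 <;> cases y.1 <;> simp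
  · rintro _ rfl x
    simp [fourCycle]
  · simp
  · simp
  · rintro _ rfl x y h
    exact h
  · rintro _ rfl x
    exact (ncard_neighborSet_fourCycle x).le
  · rintro _ rfl
    exact ⟨(true, true), ncard_neighborSet_fourCycle _⟩

theorem Forces.round_of_exists {V : Type*} {Goal : List (V × V) → Prop} {F : Set (SimpleGraph V)}
    {m : List (V × V)} (S : Finset ℕ) (hS : S.Nonempty)
    (hdeg : ∀ G ∈ F, ∀ x y, (residual G m).Adj x y → ((residual G m).neighborSet x).ncard ∈ S)
    (h : ∀ d ∈ S, ∃ (x y : V), ∃ F' ⊆ F, (∀ G ∈ F', (residual G m).Adj x y ∧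
      ((residual G m).neighborSet x).ncard = d) ∧ Forces Goal F' (m ++ [(x, y)])) :
    Forces Goal F m := by
  obtain ⟨d₀, hd₀⟩ := hS
  obtain ⟨v, -⟩ := h d₀ hd₀
  have : Nonempty V := ⟨v⟩
  choose! x y F' h1 h2 h3 using h
  exact Forces.round S ⟨d₀, hd₀⟩ x y F' hdeg h1 h2 h3

/-! ### Gadgets, trap graphs and their degrees -/

/-- The local structure of a cluster: every hub and every gate is adjacent to a set of leaves. Gates
and hubs are indexed by `Fin ℓ ⊕ Fin κ`, and so are the leaves, each being the partner of the gate or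
hub with the same index. The leaves that are adjacent to a gate depend on a parameter, by which the
degree of a gate other than the last one can be adjusted. -/
structure Gadget (Δ ℓ κ : ℕ) where
  hub : Fin κ → Finset (Fin ℓ ⊕ Fin κ)
  gate : ℕ → Fin ℓ → Finset (Fin ℓ ⊕ Fin κ)
  two_le_length : 2 ≤ ℓ
  mem_hub : ∀ k, Sum.inr k ∈ hub k
  mem_gate : ∀ d j, Sum.inl j ∈ gate d j
  two_le_card_hub : ∀ k, 2 ≤ (hub k).card
  card_hub_le : ∀ k, (hub k).card ≤ Δ
  card_gate : ∀ d, 2 ≤ d → d ≤ Δ → ∀ j : Fin ℓ, (j : ℕ) + 1 ≠ ℓ → (gate d j).card + 1 = d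
  card_gate_last : ∀ d, ∀ j : Fin ℓ, (j : ℕ) + 1 = ℓ → (gate d j).card + 1 = Δ
  card_leaf_le : ∀ d : Fin ℓ → ℕ, (∀ j, 2 ≤ d j ∧ d j ≤ Δ) → ∀ z,
    (Finset.univ.filter fun x => z ∈ Sum.elim (fun j => gate (d j) j) hub x).card ≤ Δ
  two_le_card_leaf : ∀ d : Fin ℓ → ℕ, (∀ j, 2 ≤ d j ∧ d j ≤ Δ) → ∀ z,
    2 ≤ (Finset.univ.filter fun x => z ∈ Sum.elim (fun j => gate (d j) j) hub x ∧
      ∀ j : Fin ℓ, x = Sum.inl j → (j : ℕ) + 1 = ℓ).card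

variable {Δ ℓ κ T : ℕ}

/-- The nodes of the trap graph: there are `T` clusters on each side, a cluster consists of gates and
hubs (`Sum.inl`) and of leaves (`Sum.inr`). -/
abbrev Node (ℓ κ T : ℕ) : Type := Bool × Fin T × ((Fin ℓ ⊕ Fin κ) ⊕ (Fin ℓ ⊕ Fin κ))

/-- The round in which the `j`-th gate of the `t`-th cluster on side `s` is to be matched. -/
def time (ℓ : ℕ) (s : Bool) (t j : ℕ) : ℕ := t * ℓ + j + if s then 0 else 1

namespace Gadget

variable (g : Gadget Δ ℓ κ)

/-- The leaves adjacent to a gate or hub, given the parameters of the gates. -/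
def leaves (d : Fin ℓ → ℕ) : Fin ℓ ⊕ Fin κ → Finset (Fin ℓ ⊕ Fin κ) :=
  Sum.elim (fun j => g.gate (d j) j) g.hub

/-- Adjacency in the trap graph. -/
def TrapAdj (T : ℕ) (D : ℕ → ℕ) : Node ℓ κ T → Node ℓ κ T → Prop
  | (s, t, .inl x), (s', t', .inr z) =>
      s = s' ∧ t = t' ∧ z ∈ g.leaves (fun j => D (time ℓ s t j)) x
  | (s, t, .inr z), (s', t', .inl x) =>
      s = s' ∧ t = t' ∧ z ∈ g.leaves (fun j => D (time ℓ s t j)) x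
  | (s, t, .inl (.inl j)), (s', t', .inl (.inl j')) => s ≠ s' ∧ time ℓ s t j = time ℓ s' t' j'
  | _, _ => False

/-- The trap graph: `2T` disjoint clusters, and gates on opposite sides are joined if they have the
same time. -/
def trap (T : ℕ) (D : ℕ → ℕ) : SimpleGraph (Node ℓ κ T) where
  Adj := g.TrapAdj T D
  symm := ⟨by
    rintro ⟨s, t, (j | k) | z⟩ ⟨s', t', (j' | k') | z'⟩ <;> simp only [TrapAdj, imp_self]
    · exact fun h => ⟨h.1.symm, h.2.symm⟩
    all_goals
      rintro ⟨rfl, rfl, h⟩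
      exact ⟨rfl, rfl, h⟩⟩
  loopless := ⟨by
    rintro ⟨s, t, (j | k) | z⟩ <;> simp [TrapAdj]⟩

variable {g} {D : ℕ → ℕ}

theorem trap_adj_leaf {s s' : Bool} {t t' : Fin T} {x z : Fin ℓ ⊕ Fin κ} :
    (g.trap T D).Adj (s, t, .inl x) (s', t', .inr z) ↔
      s = s' ∧ t = t' ∧ z ∈ g.leaves (fun j => D (time ℓ s t j)) x := by
  simp [trap, TrapAdj]

theorem trap_adj_leaf' {s s' : Bool} {t t' : Fin T} {x z : Fin ℓ ⊕ Fin κ} :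
    (g.trap T D).Adj (s, t, .inr z) (s', t', .inl x) ↔
      s = s' ∧ t = t' ∧ z ∈ g.leaves (fun j => D (time ℓ s t j)) x := by
  simp [trap, TrapAdj]

theorem trap_adj_gate {s s' : Bool} {t t' : Fin T} {j j' : Fin ℓ} :
    (g.trap T D).Adj (s, t, .inl (.inl j)) (s', t', .inl (.inl j')) ↔
      s ≠ s' ∧ time ℓ s t j = time ℓ s' t' j' := by
  simp [trap, TrapAdj]

theorem trap_not_adj_hub {s s' : Bool} {t t' : Fin T} {k : Fin κ} {x : Fin ℓ ⊕ Fin κ} :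
    ¬ (g.trap T D).Adj (s, t, .inl (.inr k)) (s', t', .inl x) := by
  cases x <;> simp [trap, TrapAdj]

theorem trap_not_adj_hub' {s s' : Bool} {t t' : Fin T} {k : Fin κ} {x : Fin ℓ ⊕ Fin κ} :
    ¬ (g.trap T D).Adj (s, t, .inl x) (s', t', .inl (.inr k)) := by
  cases x <;> simp [trap, TrapAdj]

theorem trap_not_adj_leaves {s s' : Bool} {t t' : Fin T} {z z' : Fin ℓ ⊕ Fin κ} :
    ¬ (g.trap T D).Adj (s, t, .inr z) (s', t', .inr z') := by
  simp [trap, TrapAdj]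

end Gadget

/-- The times are 0, …, Tℓ - 1 on side `true` and 1, …, Tℓ on side `false`. Thus only the gates of
time 0 and Tℓ have no counterpart, and Tℓ - 1 pairs remain. -/
theorem exists_time_eq {s : Bool} {i : ℕ} (h1 : s = false → 0 < i)
    (h2 : i < T * ℓ) : ∃ (t : Fin T) (j : Fin ℓ), time ℓ s t j = i := by
  have hℓ : 0 < ℓ := Nat.pos_of_ne_zero (by rintro rfl; simp at h2)
  have key : ∀ i < T * ℓ, ∃ (t : Fin T) (j : Fin ℓ), (t : ℕ) * ℓ + j = i := fun i hi =>
    ⟨⟨i / ℓ, Nat.div_lt_of_lt_mul (by rwa [mul_comm])⟩, ⟨i % ℓ, Nat.mod_lt _ hℓ⟩,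
      Nat.div_add_mod' i ℓ⟩
  cases s with
  | true => simpa [time] using key i h2
  | false =>
    obtain ⟨t, j, h⟩ := key (i - 1) (by omega)
    have := h1 rfl
    exact ⟨t, j, by simp only [time, h]; simp; omega⟩

theorem time_injective {s : Bool} {t t' : Fin T} {j j' : Fin ℓ}
    (h : time ℓ s t j = time ℓ s t' j') : t = t' ∧ j = j' := by
  have h' : (t : ℕ) * ℓ + j = t' * ℓ + j' := by simpa [time] using h
  have hℓ : 0 < ℓ := j.pos
  have h1 := congrArg (· / ℓ) h'
  have h2 := congrArg (· % ℓ) h'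
  simp only [Nat.mul_add_mod', Nat.mod_eq_of_lt j.2, Nat.mod_eq_of_lt j'.2] at h2
  simp only [add_comm, Nat.add_mul_div_right _ _ hℓ, Nat.div_eq_of_lt j.2, Nat.div_eq_of_lt j'.2,
    add_zero] at h1
  exact ⟨Fin.ext h1, Fin.ext h2⟩

/-- The admissible parameters of the gates. -/
def IsDegreeChoice (Δ : ℕ) (D : ℕ → ℕ) : Prop := D 0 = 3 ∧ ∀ i, 2 ≤ D i ∧ D i ≤ Δ

namespace Gadget

variable {g : Gadget Δ ℓ κ} {D : ℕ → ℕ}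

theorem self_mem_leaves (d : Fin ℓ → ℕ) (x : Fin ℓ ⊕ Fin κ) : x ∈ g.leaves d x := by
  cases x
  · exact g.mem_gate _ _
  · exact g.mem_hub _

theorem card_gate_add_one_le {d : ℕ} (hd : 2 ≤ d ∧ d ≤ Δ) (j : Fin ℓ) :
    (g.gate d j).card + 1 ≤ Δ := by
  by_cases hj : (j : ℕ) + 1 = ℓ
  · exact (g.card_gate_last d j hj).le
  · exact (g.card_gate d hd.1 hd.2 j hj).le.trans hd.2

theorem neighborSet_leaf (s : Bool) (t : Fin T) (z : Fin ℓ ⊕ Fin κ) :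
    (g.trap T D).neighborSet (s, t, .inr z) = (fun x => (s, t, Sum.inl x)) ''
      {x | z ∈ g.leaves (fun j => D (time ℓ s t j)) x} := by
  ext ⟨s', t', x | z'⟩
  · simp only [SimpleGraph.mem_neighborSet, trap_adj_leaf', Set.mem_image, Set.mem_ofPred_eq,
      Prod.mk.injEq, Sum.inl.injEq]
    constructor
    · rintro ⟨rfl, rfl, h⟩
      exact ⟨x, h, rfl, rfl, rfl⟩
    · rintro ⟨x, h, rfl, rfl, rfl⟩
      exact ⟨rfl, rfl, h⟩
  · simp [trap_not_adj_leaves]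

theorem neighborSet_hub (s : Bool) (t : Fin T) (k : Fin κ) :
    (g.trap T D).neighborSet (s, t, .inl (.inr k)) =
      (fun z => (s, t, Sum.inr z)) '' (g.hub k : Set (Fin ℓ ⊕ Fin κ)) := by
  ext ⟨s', t', x | z'⟩
  · simp [trap_not_adj_hub]
  · simp only [SimpleGraph.mem_neighborSet, trap_adj_leaf, Set.mem_image, Prod.mk.injEq,
      Sum.inr.injEq, leaves, Sum.elim_inr, Finset.mem_coe]
    constructor
    · rintro ⟨rfl, rfl, h⟩
      exact ⟨z', h, rfl, rfl, rfl⟩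
    · rintro ⟨x, h, rfl, rfl, rfl⟩
      exact ⟨rfl, rfl, h⟩

theorem neighborSet_gate (s : Bool) (t : Fin T) (j : Fin ℓ) :
    (g.trap T D).neighborSet (s, t, .inl (.inl j)) =
      (fun z => (s, t, Sum.inr z)) '' (g.gate (D (time ℓ s t j)) j : Set (Fin ℓ ⊕ Fin κ)) ∪
      {y | ∃ (t' : Fin T) (j' : Fin ℓ), time ℓ s t j = time ℓ (!s) t' j' ∧ y = (!s, t', .inl (.inl j'))} := by
  ext ⟨s', t', (j' | k) | z'⟩
  · simp only [SimpleGraph.mem_neighborSet, trap_adj_gate, Set.mem_union, Set.mem_image,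
      Set.mem_ofPred_eq, Prod.mk.injEq, Sum.inl.injEq, reduceCtorEq, and_false, exists_false,
      false_or]
    constructor
    · rintro ⟨h1, h2⟩
      obtain rfl : s' = !s := by cases s <;> cases s' <;> simp_all
      exact ⟨t', j', h2, rfl, rfl, rfl⟩
    · rintro ⟨t, j, h, rfl, rfl, rfl⟩
      exact ⟨by cases s <;> simp, h⟩
  · simp [trap_not_adj_hub']
  · simp only [SimpleGraph.mem_neighborSet, trap_adj_leaf, Set.mem_image, Prod.mk.injEq,
      Sum.inr.injEq, leaves, Sum.elim_inl, Finset.mem_coe, Set.mem_union, Set.mem_ofPred_eq,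
      reduceCtorEq, and_false, exists_false, or_false]
    constructor
    · rintro ⟨rfl, rfl, h⟩
      exact ⟨z', h, rfl, rfl, rfl⟩
    · rintro ⟨x, h, rfl, rfl, rfl⟩
      exact ⟨rfl, rfl, h⟩

theorem injective_leaf (s : Bool) (t : Fin T) :
    Function.Injective fun z : Fin ℓ ⊕ Fin κ => ((s, t, Sum.inr z) : Node ℓ κ T) :=
  fun _ _ h => by simpa using h

theorem injective_nonleaf (s : Bool) (t : Fin T) :
    Function.Injective fun z : Fin ℓ ⊕ Fin κ => ((s, t, Sum.inl z) : Node ℓ κ T) :=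
  fun _ _ h => by simpa using h

theorem ncard_neighborSet_gate {s : Bool} {t t' : Fin T} {j j' : Fin ℓ}
    (h : time ℓ (!s) t' j' = time ℓ s t j) :
    ((g.trap T D).neighborSet (s, t, .inl (.inl j))).ncard =
      (g.gate (D (time ℓ s t j)) j).card + 1 := by
  have : {y : Node ℓ κ T | ∃ (t' : Fin T) (j' : Fin ℓ), time ℓ s t j = time ℓ (!s) t' j' ∧
      y = (!s, t', .inl (.inl j'))} = {(!s, t', .inl (.inl j'))} := by
    ext y
    simp only [Set.mem_ofPred_eq, Set.mem_singleton_iff]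
    constructor
    · rintro ⟨t'', j'', h', rfl⟩
      obtain ⟨rfl, rfl⟩ := time_injective (h.trans h')
      rfl
    · rintro rfl
      exact ⟨t', j', h.symm, rfl⟩
  rw [neighborSet_gate, this, Set.ncard_union_eq (by simp) (Set.toFinite _) (Set.toFinite _),
    Set.ncard_image_of_injective _ (injective_leaf s t), Set.ncard_coe_finset, Set.ncard_singleton]

theorem card_gate_le_ncard_neighborSet (s : Bool) (t : Fin T) (j : Fin ℓ) :
    (g.gate (D (time ℓ s t j)) j).card ≤
      ((g.trap T D).neighborSet (s, t, .inl (.inl j))).ncard := by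
  rw [neighborSet_gate, ← Set.ncard_coe_finset,
    ← Set.ncard_image_of_injective _ (injective_leaf s t)]
  exact Set.ncard_le_ncard Set.subset_union_left (Set.toFinite _)

theorem ncard_neighborSet_le (hD : IsDegreeChoice Δ D) (x : Node ℓ κ T) :
    ((g.trap T D).neighborSet x).ncard ≤ Δ := by
  obtain ⟨s, t, (j | k) | z⟩ := x
  · by_cases h : ∃ (t' : Fin T) (j' : Fin ℓ), time ℓ (!s) t' j' = time ℓ s t j
    · obtain ⟨t', j', h⟩ := h
      rw [ncard_neighborSet_gate h]
      exact card_gate_add_one_le (hD.2 _) j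
    · have : {y : Node ℓ κ T | ∃ (t' : Fin T) (j' : Fin ℓ), time ℓ s t j = time ℓ (!s) t' j' ∧
          y = (!s, t', .inl (.inl j'))} = ∅ := by
        ext y
        simp only [Set.mem_ofPred_eq, Set.mem_empty_iff_false, iff_false]
        rintro ⟨t', j', h', -⟩
        exact h ⟨t', j', h'.symm⟩
      rw [neighborSet_gate, this, Set.union_empty,
        Set.ncard_image_of_injective _ (injective_leaf s t), Set.ncard_coe_finset]
      exact (Nat.le_succ _).trans (card_gate_add_one_le (hD.2 _) j)
  · rw [neighborSet_hub, Set.ncard_image_of_injective _ (injective_leaf s t),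
      Set.ncard_coe_finset]
    exact g.card_hub_le k
  · rw [neighborSet_leaf, Set.ncard_image_of_injective _ (injective_nonleaf s t)]
    have := g.card_leaf_le (fun j => D (time ℓ s t j)) (fun j => hD.2 _) z
    rw [← Set.ncard_coe_finset] at this
    simpa [leaves] using this

/-- The last gate of the first cluster on side `false` has Δ - 1 leaves and time ℓ, and 2 ≤ T
provides its counterpart. -/
theorem exists_ncard_neighborSet_eq (hT : 2 ≤ T) :
    ∃ x, ((g.trap T D).neighborSet x).ncard = Δ := by
  have hℓ := g.two_le_length
  obtain ⟨t', j', h⟩ := exists_time_eq (T := T) (s := true) (i := ℓ) (ℓ := ℓ) (by simp)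
    (by nlinarith)
  refine ⟨(false, ⟨0, by omega⟩, .inl (.inl ⟨ℓ - 1, by omega⟩)), ?_⟩
  rw [ncard_neighborSet_gate (t' := t') (j' := j')]
  · exact g.card_gate_last _ _ (by simp; omega)
  · rw [Bool.not_false, h]
    simp [time]
    omega

/-! ### Live and dead nodes of the reduced graph -/

/-- The nodes of the clusters some gates of which are to be matched after round `k`, except the gates
that are to be matched up to round `k`. -/
def IsLive (k : ℕ) (x : Node ℓ κ T) : Prop :=
  k < time ℓ x.1 x.2.1 (ℓ - 1) ∧ ∀ j : Fin ℓ, x.2.2 = .inl (.inl j) →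
    k < time ℓ x.1 x.2.1 j ∨ time ℓ x.1 x.2.1 j = 0

theorem time_le_time_last (s : Bool) (t : ℕ) (j : Fin ℓ) : time ℓ s t j ≤ time ℓ s t (ℓ - 1) := by
  have := j.2
  simp only [time]
  omega

theorem isLive_gate {k : ℕ} {s : Bool} {t : Fin T} {j : Fin ℓ} (h : k < time ℓ s t j) :
    IsLive (κ := κ) k (s, t, .inl (.inl j)) := by
  refine ⟨h.trans_le (time_le_time_last s t j), fun j' hj' => Or.inl ?_⟩
  obtain rfl : j = j' := by simpa using hj'
  exact h

theorem isLive_leaf {k : ℕ} {s : Bool} {t : Fin T} {z : Fin ℓ ⊕ Fin κ} :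
    IsLive (κ := κ) k (s, t, .inr z) ↔ k < time ℓ s t (ℓ - 1) := by
  simp [IsLive]

theorem isLive_hub {k : ℕ} {s : Bool} {t : Fin T} {i : Fin κ} :
    IsLive (ℓ := ℓ) k (s, t, .inl (.inr i)) ↔ k < time ℓ s t (ℓ - 1) := by
  simp [IsLive]

theorem time_pos_of_ne {s s' : Bool} (hs : s ≠ s') {t t' j j' : ℕ}
    (h : time ℓ s t j = time ℓ s' t' j') : 0 < time ℓ s t j := by
  cases s <;> cases s' <;>
    simp only [time, ne_eq, not_true_eq_false, if_true, Bool.false_eq_true, if_false] at hs h ⊢ <;>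
    omega

/-- A leaf lives as long as its cluster, and the opposite gate has the same time. So a live gate
keeps the full degree set by its parameter until its own round. -/
theorem IsLive.of_gate_adj {k : ℕ} {s : Bool} {t : Fin T} {j : Fin ℓ} {y : Node ℓ κ T}
    (h : IsLive (κ := κ) k (s, t, .inl (.inl j)))
    (hy : (g.trap T D).Adj (s, t, .inl (.inl j)) y) : IsLive k y := by
  obtain ⟨s', t', (j' | i) | z⟩ := y
  · obtain ⟨hs, ht⟩ := trap_adj_gate.1 hy
    have hpos := time_pos_of_ne hs ht
    refine isLive_gate (ht ▸ (h.2 j rfl).resolve_right hpos.ne')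
  · exact absurd hy trap_not_adj_hub'
  · obtain ⟨rfl, rfl, -⟩ := trap_adj_leaf.1 hy
    exact isLive_leaf.2 h.1

variable {m : List (Node ℓ κ T × Node ℓ κ T)} {k : ℕ}

theorem neighborSet_residual_gate (hm : ∀ x, IsLive k x → x ∉ touched m) {s : Bool} {t : Fin T}
    {j : Fin ℓ} (h : IsLive (κ := κ) k (s, t, .inl (.inl j))) :
    (residual (g.trap T D) m).neighborSet (s, t, .inl (.inl j)) =
      (g.trap T D).neighborSet (s, t, .inl (.inl j)) := by
  ext y
  simp only [SimpleGraph.mem_neighborSet, residual]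
  exact ⟨And.left, fun hy => ⟨hy, hm _ h, hm _ (h.of_gate_adj hy)⟩⟩

/-- A gate with a counterpart has its own leaf besides. The gate of time 0 has no counterpart; `D 0
= 3` gives it two leaves unless it is a last gate, and a last gate has Δ - 1 ≥ 2 leaves. -/
theorem two_le_ncard_neighborSet_gate (hΔ : 3 ≤ Δ) (hD : IsDegreeChoice Δ D) (s : Bool)
    (t : Fin T) (j : Fin ℓ) : 2 ≤ ((g.trap T D).neighborSet (s, t, .inl (.inl j))).ncard := by
  by_cases hj : (j : ℕ) + 1 = ℓ
  · have := g.card_gate_last (D (time ℓ s t j)) j hj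
    exact le_trans (by omega) (card_gate_le_ncard_neighborSet s t j)
  · have hc := g.card_gate _ (hD.2 (time ℓ s t j)).1 (hD.2 (time ℓ s t j)).2 j hj
    rcases Nat.eq_zero_or_pos (time ℓ s t j) with h0 | h0
    · rw [h0, hD.1] at hc
      refine le_trans ?_ (card_gate_le_ncard_neighborSet s t j)
      rw [h0, hD.1]
      omega
    · have hlt : time ℓ s t j < T * ℓ := by
        have h1 := j.2
        have h2 : ((t : ℕ) + 1) * ℓ ≤ T * ℓ := Nat.mul_le_mul_right _ t.2
        have h3 : time ℓ s t j ≤ t * ℓ + j + 1 := by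
          simp only [time]; split_ifs <;> omega
        rw [add_mul, one_mul] at h2
        omega
      obtain ⟨t', j', h⟩ := exists_time_eq (s := !s) (fun _ => h0) hlt
      rw [ncard_neighborSet_gate h, hc]
      exact (hD.2 _).1

theorem two_le_ncard_of_isLive (hΔ : 3 ≤ Δ) (hD : IsDegreeChoice Δ D)
    (hm : ∀ x, IsLive k x → x ∉ touched m) {x : Node ℓ κ T} (hx : IsLive k x) :
    2 ≤ ((residual (g.trap T D) m).neighborSet x).ncard := by
  obtain ⟨s, t, (j | i) | z⟩ := x
  · rw [neighborSet_residual_gate hm hx]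
    exact two_le_ncard_neighborSet_gate hΔ hD s t j
  · refine (g.two_le_card_hub i).trans ?_
    rw [← Set.ncard_coe_finset, ← Set.ncard_image_of_injective _ (injective_leaf s t),
      ← neighborSet_hub (D := D)]
    refine Set.ncard_le_ncard (fun y hy => ⟨hy, hm _ hx, hm _ ?_⟩) (Set.toFinite _)
    rw [neighborSet_hub] at hy
    obtain ⟨z, -, rfl⟩ := hy
    exact isLive_leaf.2 (isLive_hub.1 hx)
  -- Only hubs and the last gate are counted: they stay as long as the cluster is live, while
  -- earlier gates may be gone.
  · refine (g.two_le_card_leaf (fun j => D (time ℓ s t j)) (fun j => hD.2 _) z).trans ?_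
    rw [← Set.ncard_coe_finset, ← Set.ncard_image_of_injective _ (injective_nonleaf s t)]
    refine Set.ncard_le_ncard ?_ (Set.toFinite _)
    rintro _ ⟨x, hz, rfl⟩
    rw [Finset.mem_coe, Finset.mem_filter] at hz
    refine ⟨trap_adj_leaf'.2 ⟨rfl, rfl, hz.2.1⟩, hm _ hx, hm _ ?_⟩
    rw [isLive_leaf] at hx
    cases x with
    | inl j =>
      refine isLive_gate (hx.trans_eq ?_)
      have := hz.2.2 j rfl
      congr 1
      omega
    | inr i => exact isLive_hub.2 hx

theorem time_last_le_of_not_isLive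
    (hm : ∀ s (t : Fin T) (j : Fin ℓ), 0 < time ℓ s t j → time ℓ s t j ≤ k →
      (s, t, .inl (.inl j)) ∈ touched m)
    {x : Node ℓ κ T} (hx : ¬ IsLive k x) (hxm : x ∉ touched m) :
    time ℓ x.1 x.2.1 (ℓ - 1) ≤ k := by
  by_contra! h
  refine hx ⟨h, fun j hj => ?_⟩
  by_contra! h'
  refine hxm ?_
  obtain ⟨s, t, y⟩ := x
  obtain rfl : y = _ := hj
  exact hm s t j (Nat.pos_of_ne_zero h'.2) h'.1

/-- A dead unmatched node lies in a cluster all of whose gates of positive time are matched, so no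
remaining edge leaves this cluster. -/
theorem not_isLive_of_residual_adj
    (hm : ∀ s (t : Fin T) (j : Fin ℓ), 0 < time ℓ s t j → time ℓ s t j ≤ k →
      (s, t, .inl (.inl j)) ∈ touched m)
    {x y : Node ℓ κ T} (hx : ¬ IsLive k x) (h : (residual (g.trap T D) m).Adj x y) :
    ¬ IsLive k y := by
  obtain ⟨hxy, hxm, hym⟩ := h
  have hτ := time_last_le_of_not_isLive hm hx hxm
  intro hy
  have hy1 := hy.1
  obtain ⟨s, t, (j | i) | z⟩ := x <;> obtain ⟨s', t', (j' | i') | z'⟩ := y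
  · obtain ⟨hs, ht⟩ := trap_adj_gate.1 hxy
    exact hxm (hm s t j (time_pos_of_ne hs ht) ((time_le_time_last s t j).trans hτ))
  · exact trap_not_adj_hub' hxy
  · obtain ⟨rfl, rfl, -⟩ := trap_adj_leaf.1 hxy
    exact hy1.not_ge hτ
  · exact trap_not_adj_hub hxy
  · exact trap_not_adj_hub hxy
  · obtain ⟨rfl, rfl, -⟩ := trap_adj_leaf.1 hxy
    exact hy1.not_ge hτ
  · obtain ⟨rfl, rfl, -⟩ := trap_adj_leaf'.1 hxy
    exact hy1.not_ge hτ
  · obtain ⟨rfl, rfl, -⟩ := trap_adj_leaf'.1 hxy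
    exact hy1.not_ge hτ
  · exact trap_not_adj_leaves hxy

/-- The edges of a dead cluster depend only on parameters with index at most `k`, which are already
fixed. -/
theorem residual_adj_of_agree
    (hm : ∀ s (t : Fin T) (j : Fin ℓ), 0 < time ℓ s t j → time ℓ s t j ≤ k →
      (s, t, .inl (.inl j)) ∈ touched m)
    {D' : ℕ → ℕ} (hDD' : ∀ i ≤ k, D' i = D i) {x y : Node ℓ κ T} (hx : ¬ IsLive k x)
    (h : (residual (g.trap T D) m).Adj x y) : (residual (g.trap T D') m).Adj x y := by
  obtain ⟨hxy, hxm, hym⟩ := h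
  have hτ := time_last_le_of_not_isLive hm hx hxm
  refine ⟨?_, hxm, hym⟩
  obtain ⟨s, t, x⟩ := x
  have hD : (fun j : Fin ℓ => D' (time ℓ s t j)) = fun j : Fin ℓ => D (time ℓ s t j) :=
    funext fun j => hDD' _ ((time_le_time_last s t j).trans hτ)
  obtain x | z := x <;> obtain ⟨s', t', x' | z'⟩ := y
  · obtain j | i := x <;> obtain j' | i' := x'
    · exact trap_adj_gate.2 (trap_adj_gate.1 hxy)
    · exact absurd hxy trap_not_adj_hub'
    · exact absurd hxy trap_not_adj_hub
    · exact absurd hxy trap_not_adj_hub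
  · rw [trap_adj_leaf, hD]
    exact trap_adj_leaf.1 hxy
  · rw [trap_adj_leaf', hD]
    exact trap_adj_leaf'.1 hxy
  · exact absurd hxy trap_not_adj_leaves

end Gadget

/-! ### The strategy of the adversary -/

/-- The gates and hubs. -/
def nonleaves (ℓ κ T : ℕ) : Finset (Node ℓ κ T) := Finset.univ.filter fun x => x.2.2.isLeft

theorem mem_nonleaves {s : Bool} {t : Fin T} {y : (Fin ℓ ⊕ Fin κ) ⊕ (Fin ℓ ⊕ Fin κ)} :
    (s, t, y) ∈ nonleaves ℓ κ T ↔ y.isLeft := by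
  simp [nonleaves]

theorem card_nonleaves : (nonleaves ℓ κ T).card = 2 * (T * (ℓ + κ)) := by
  have hinj : Function.Injective fun x : Bool × Fin T × (Fin ℓ ⊕ Fin κ) =>
      ((x.1, x.2.1, Sum.inl x.2.2) : Node ℓ κ T) := by
    rintro ⟨a, b, c⟩ ⟨a', b', c'⟩ h
    simpa using h
  have : nonleaves ℓ κ T = Finset.univ.image fun x : Bool × Fin T × (Fin ℓ ⊕ Fin κ) =>
      ((x.1, x.2.1, Sum.inl x.2.2) : Node ℓ κ T) := by
    ext ⟨s, t, x | z⟩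
    · exact iff_of_true (mem_nonleaves.2 rfl)
        (Finset.mem_image.2 ⟨(s, t, x), Finset.mem_univ _, rfl⟩)
    · refine iff_of_false (by simp [mem_nonleaves]) fun h => ?_
      obtain ⟨x, -, h⟩ := Finset.mem_image.1 h
      simp at h
  rw [this, Finset.card_image_of_injective _ hinj]
  simp

namespace Gadget

variable (g : Gadget Δ ℓ κ)

/-- The trap graphs whose parameters agree with those of `D` up to the index `k`. -/
def trapFamily (T k : ℕ) (D : ℕ → ℕ) : Set (SimpleGraph (Node ℓ κ T)) :=
  {G | ∃ D', IsDegreeChoice Δ D' ∧ (∀ i ≤ k, D' i = D i) ∧ G = g.trap T D'}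

variable {g}

theorem trapFamily_mono {T k k' : ℕ} {D D' : ℕ → ℕ} (hk : k ≤ k') (hD : ∀ i ≤ k, D' i = D i) :
    g.trapFamily T k' D' ⊆ g.trapFamily T k D := by
  rintro _ ⟨E, hE, hED, rfl⟩
  exact ⟨E, hE, fun i hi => (hED i (hi.trans hk)).trans (hD i hi), rfl⟩

/-- The position after the first `k` pairs of gates have been matched and no other live node. -/
structure IsPosition (T k : ℕ) (m : List (Node ℓ κ T × Node ℓ κ T)) : Prop where
  live : ∀ x, IsLive k x → x ∉ touched m
  gate : ∀ s (t : Fin T) (j : Fin ℓ), 0 < time ℓ s t j → time ℓ s t j ≤ k →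
    (s, t, .inl (.inl j)) ∈ touched m
  count : k ≤ pairsIn (nonleaves ℓ κ T) m

theorem IsLive.of_succ {k : ℕ} {x : Node ℓ κ T} (hx : IsLive (k + 1) x) : IsLive k x :=
  ⟨(Nat.lt_succ_self k).trans hx.1, fun j hj =>
    (hx.2 j hj).imp_left fun h => (Nat.lt_succ_self k).trans h⟩

theorem not_isLive_gate {k : ℕ} {s : Bool} {t : Fin T} {j : Fin ℓ} (h : time ℓ s t j = k + 1) :
    ¬ IsLive (κ := κ) (k + 1) (s, t, .inl (.inl j)) := fun hl => by
  have := hl.2 j rfl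
  simp only at this
  omega

theorem IsPosition.dead_move {k : ℕ} {m : List (Node ℓ κ T × Node ℓ κ T)} (hm : IsPosition T k m)
    {x y : Node ℓ κ T} (hx : ¬ IsLive k x) (hy : ¬ IsLive k y) :
    IsPosition T k (m ++ [(x, y)]) where
  live z hz := by
    rw [touched_append_singleton]
    rintro (rfl | rfl | h)
    · exact hx hz
    · exact hy hz
    · exact hm.live z hz h
  gate s t j h1 h2 := by
    rw [touched_append_singleton]
    exact Or.inr (Or.inr (hm.gate s t j h1 h2))
  count := hm.count.trans (by rw [pairsIn_append_singleton]; exact Nat.le_add_right _ _)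

theorem IsPosition.gate_move {k : ℕ} {m : List (Node ℓ κ T × Node ℓ κ T)} (hm : IsPosition T k m)
    {s : Bool} {t t' : Fin T} {j j' : Fin ℓ} (h : time ℓ s t j = k + 1)
    (h' : time ℓ (!s) t' j' = k + 1) :
    IsPosition T (k + 1) (m ++ [((s, t, .inl (.inl j)), (!s, t', .inl (.inl j')))]) where
  live z hz := by
    rw [touched_append_singleton]
    rintro (rfl | rfl | hz')
    · exact not_isLive_gate h hz
    · exact not_isLive_gate h' hz
    · exact hm.live z hz.of_succ hz'
  gate s₁ t₁ j₁ h1 h2 := by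
    rw [touched_append_singleton]
    rcases h2.lt_or_eq with h2 | h2
    · exact Or.inr (Or.inr (hm.gate s₁ t₁ j₁ h1 (Nat.lt_succ_iff.1 h2)))
    · by_cases hs : s₁ = s
      · subst hs
        obtain ⟨rfl, rfl⟩ := time_injective (h2.trans h.symm)
        exact Or.inl rfl
      · obtain rfl : s₁ = !s := by cases s <;> cases s₁ <;> simp_all
        obtain ⟨rfl, rfl⟩ := time_injective (h2.trans h'.symm)
        exact Or.inr (Or.inl rfl)
  count := by
    have := hm.count
    rw [pairsIn_append_singleton, if_pos ⟨mem_nonleaves.2 rfl, mem_nonleaves.2 rfl⟩]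
    exact Nat.succ_le_succ this

/-- Because of the shift by one between the sides, two last gates never have the same time: this
would give 1 ≡ 0 modulo ℓ ≥ 2. So one gate of the pair has adjustable degree, and it goes first in
the answer. -/
theorem exists_gate_pair (g : Gadget Δ ℓ κ) {k : ℕ} (hk : k + 1 < T * ℓ) :
    ∃ (s : Bool) (t t' : Fin T) (j j' : Fin ℓ), time ℓ s t j = k + 1 ∧
      time ℓ (!s) t' j' = k + 1 ∧ (j : ℕ) + 1 ≠ ℓ := by
  obtain ⟨t, j, h⟩ := exists_time_eq (s := true) (i := k + 1) (by simp) hk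
  obtain ⟨t', j', h'⟩ := exists_time_eq (s := false) (i := k + 1) (by simp) hk
  by_cases hj : (j : ℕ) + 1 = ℓ
  · refine ⟨false, t', t, j', j, h', h, fun hj' => ?_⟩
    have hℓ := g.two_le_length
    simp only [time, if_true, Bool.false_eq_true, if_false] at h h'
    have h1 : (t : ℕ) * ℓ = t' * ℓ + 1 := by omega
    have h2 := congrArg (· % ℓ) h1
    simp only [Nat.mul_mod_left, Nat.mul_add_mod', Nat.mod_eq_of_lt hℓ] at h2
    omega
  · exact ⟨true, t, t', j, j', h, h', hj⟩

theorem isDegreeChoice_update {D : ℕ → ℕ} (hD : IsDegreeChoice Δ D) {k d : ℕ}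
    (hd : 2 ≤ d ∧ d ≤ Δ) : IsDegreeChoice Δ (Function.update D (k + 1) d) := by
  refine ⟨by rw [Function.update_of_ne (by omega)]; exact hD.1, fun i => ?_⟩
  by_cases hi : i = k + 1
  · subst hi
    simpa using hd
  · rw [Function.update_of_ne hi]
    exact hD.2 i

theorem ncard_compl_touched_lt {m : List (Node ℓ κ T × Node ℓ κ T)} {x : Node ℓ κ T}
    (hx : x ∉ touched m) (y : Node ℓ κ T) :
    (touched (m ++ [(x, y)]))ᶜ.ncard < (touched m)ᶜ.ncard := by
  refine Set.ncard_lt_ncard ⟨fun z hz hz' => hz ?_, fun h => ?_⟩ (Set.toFinite _)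
  · rw [touched_append_singleton]
    exact Or.inr (Or.inr hz')
  · refine h hx ?_
    rw [touched_append_singleton]
    exact Or.inl rfl

/-- The induction is on the number of untouched nodes, since a move among dead nodes leaves `k`
unchanged. -/
theorem forces_of_isPosition (hΔ : 3 ≤ Δ) {r k : ℕ} (hr : r < T * ℓ) (hk : k ≤ r)
    {D : ℕ → ℕ} (hD : IsDegreeChoice Δ D) {m : List (Node ℓ κ T × Node ℓ κ T)}
    (hm : IsPosition T k m) :
    Forces (fun m => r ≤ pairsIn (nonleaves ℓ κ T) m)
      (g.trapFamily T k D) m := by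
  induction hN : (touched m)ᶜ.ncard using Nat.strong_induction_on generalizing k D m with
  | _ N ih =>
  subst hN
  have hDmem : g.trap T D ∈ g.trapFamily T k D := ⟨D, hD, fun _ _ => rfl, rfl⟩
  rcases hk.eq_or_lt with rfl | hk
  · exact Forces.done _ hDmem hm.count
  classical
  -- Degree 1 is admitted only if a dead node has it. This can be read off from `D` alone, as the
  -- dead part is common to the whole family.
  let S : Finset ℕ := (Finset.Icc 1 Δ).filter fun d => 2 ≤ d ∨ ∃ x y, ¬ IsLive k x ∧
    (residual (g.trap T D) m).Adj x y ∧ ((residual (g.trap T D) m).neighborSet x).ncard = 1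
  have hresidual : ∀ D', (∀ i ≤ k, D' i = D i) → ∀ x, ¬ IsLive k x → ∀ y,
      (residual (g.trap T D') m).Adj x y ↔ (residual (g.trap T D) m).Adj x y :=
    fun D' hD' x hx y => ⟨residual_adj_of_agree hm.gate (fun i hi => (hD' i hi).symm) hx,
      residual_adj_of_agree hm.gate hD' hx⟩
  have hneighbor : ∀ D', (∀ i ≤ k, D' i = D i) → ∀ x, ¬ IsLive k x →
      (residual (g.trap T D') m).neighborSet x = (residual (g.trap T D) m).neighborSet x :=
    fun D' hD' x hx => Set.ext (hresidual D' hD' x hx)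
  refine Forces.round_of_exists S ⟨2, by simp [S]; omega⟩ ?_ ?_
  · rintro _ ⟨D', hD', hDD', rfl⟩ x y hxy
    have h1 : 1 ≤ ((residual (g.trap T D') m).neighborSet x).ncard :=
      (Set.ncard_pos (Set.toFinite _)).2 ⟨y, hxy⟩
    have h2 : ((residual (g.trap T D') m).neighborSet x).ncard ≤ Δ :=
      (Set.ncard_le_ncard (fun z hz => hz.1) (Set.toFinite _)).trans (ncard_neighborSet_le hD' x)
    refine Finset.mem_filter.2 ⟨Finset.mem_Icc.2 ⟨h1, h2⟩, ?_⟩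
    by_cases h3 : 2 ≤ ((residual (g.trap T D') m).neighborSet x).ncard
    · exact Or.inl h3
    · have hx : ¬ IsLive k x := fun hx => h3 (two_le_ncard_of_isLive hΔ hD' hm.live hx)
      refine Or.inr ⟨x, y, hx, (hresidual D' hDD' x hx y).1 hxy, ?_⟩
      rw [← hneighbor D' hDD' x hx]
      omega
  · intro d hd
    obtain ⟨hd1, hd2⟩ := Finset.mem_filter.1 hd
    rw [Finset.mem_Icc] at hd1
    -- For 2 ≤ d the answer is the next gate pair, with parameter `k + 1` now fixed to `d`; for d =
    -- 1 it is an edge between dead nodes, and no parameter is fixed.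
    by_cases h2 : 2 ≤ d
    · obtain ⟨s, t, t', j, j', ht, ht', hj⟩ := g.exists_gate_pair 
        (lt_of_le_of_lt (Nat.succ_le_of_lt hk) hr)
      have hlive : IsLive (κ := κ) k (s, t, .inl (.inl j)) := isLive_gate (by omega)
      have hlive' : IsLive (κ := κ) k (!s, t', .inl (.inl j')) := isLive_gate (by omega)
      refine ⟨(s, t, .inl (.inl j)), (!s, t', .inl (.inl j')),
        g.trapFamily T (k + 1) (Function.update D (k + 1) d),
        trapFamily_mono (Nat.le_succ k) (fun i hi => Function.update_of_ne (by omega) _ _), ?_,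
        ih _ (ncard_compl_touched_lt (hm.live _ hlive) _) (Nat.succ_le_of_lt hk)
          (isDegreeChoice_update hD ⟨h2, hd1.2⟩) (hm.gate_move ht ht') rfl⟩
      rintro _ ⟨D', hD', hDD', rfl⟩
      refine ⟨⟨trap_adj_gate.2 ⟨by cases s <;> simp, ht.trans ht'.symm⟩, hm.live _ hlive,
        hm.live _ hlive'⟩, ?_⟩
      rw [neighborSet_residual_gate hm.live hlive, ncard_neighborSet_gate (ht'.trans ht.symm), ht,
        hDD' _ le_rfl, Function.update_self]
      exact g.card_gate d h2 hd1.2 j hj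
    · obtain ⟨x, y, hx, hxy, hcard⟩ := hd2.resolve_left h2
      obtain rfl : d = 1 := by omega
      refine ⟨x, y, _, subset_rfl, ?_, ih _ (ncard_compl_touched_lt hxy.2.1 y) hk.le hD
        (hm.dead_move hx (not_isLive_of_residual_adj hm.gate hx hxy)) rfl⟩
      rintro _ ⟨D', hD', hDD', rfl⟩
      exact ⟨(hresidual D' hDD' x hx y).2 hxy, by rw [hneighbor D' hDD' x hx, hcard]⟩

/-- The trap graphs show that the algorithm loses all but one of the gate pairs. -/
theorem exists_card_output_le (g : Gadget Δ ℓ κ) (hΔ : 3 ≤ Δ) (hT : 2 ≤ T)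
    (A : DegreeSensitiveAlgorithm) :
    ∃ (n : ℕ) (G : SimpleGraph (Fin n)), G.IsBipartite ∧ (∀ v, (G.neighborSet v).ncard ≤ Δ) ∧
      (∃ v, (G.neighborSet v).ncard = Δ) ∧ (∃ M : G.Subgraph, M.IsPerfectMatching) ∧
      (output A G).card + (T * ℓ - 1) ≤ 2 * (T * (ℓ + κ)) ∧ 2 * (T * (ℓ + κ)) ≤ optimum G := by
  have hℓ := g.two_le_length
  have hTℓ : 0 < T * ℓ := by positivity
  rw [← card_nonleaves]
  refine exists_card_output_le_of_forces A (nonleaves ℓ κ T) (g.trapFamily T 0 fun _ => 3)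
    (fun x => (x.1, x.2.1, x.2.2.swap)) (fun x => xor x.1 x.2.2.isLeft) ?_ ?_ ?_ ?_ ?_ ?_ ?_
    (forces_of_isPosition hΔ (by omega) (Nat.zero_le _) ⟨rfl, fun _ => ⟨by omega, hΔ⟩⟩ ⟨?_, ?_, ?_⟩)
  · rintro _ ⟨D, hD, -, rfl⟩ ⟨s, t, x | z⟩ ⟨s', t', x' | z'⟩ h
    · exact Or.inl (mem_nonleaves.2 rfl)
    · exact Or.inl (mem_nonleaves.2 rfl)
    · exact Or.inr (mem_nonleaves.2 rfl)
    · exact absurd h trap_not_adj_leaves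
  · rintro _ ⟨D, hD, -, rfl⟩ ⟨s, t, x | z⟩
    · exact trap_adj_leaf.2 ⟨rfl, rfl, self_mem_leaves _ _⟩
    · exact trap_adj_leaf'.2 ⟨rfl, rfl, self_mem_leaves _ _⟩
  · simp
  · rintro ⟨s, t, x | z⟩ <;> simp [mem_nonleaves]
  · rintro _ ⟨D, hD, -, rfl⟩ ⟨s, t, x | z⟩ ⟨s', t', x' | z'⟩ h
    · obtain j | i := x <;> obtain j' | i' := x'
      · simpa using (trap_adj_gate.1 h).1
      · exact absurd h trap_not_adj_hub'
      · exact absurd h trap_not_adj_hub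
      · exact absurd h trap_not_adj_hub
    · obtain ⟨rfl, -⟩ := trap_adj_leaf.1 h
      simp
    · obtain ⟨rfl, -⟩ := trap_adj_leaf'.1 h
      simp
    · exact absurd h trap_not_adj_leaves
  · rintro _ ⟨D, hD, -, rfl⟩ x
    exact ncard_neighborSet_le hD x
  · rintro _ ⟨D, hD, -, rfl⟩
    exact exists_ncard_neighborSet_eq hT
  · simp [touched]
  · intro s t j h h'
    omega
  · simp

/-! ### Construction of gadgets -/

/-- A single hub, which is adjacent to all leaves of its cluster, as is the last gate. -/
theorem exists_of_four_le (hΔ : 4 ≤ Δ) : Nonempty (Gadget Δ (Δ - 2) 1) := by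
  have hY : Fintype.card (Fin (Δ - 2) ⊕ Fin 1) = Δ - 1 := by
    simp
    omega
  have key : ∀ (d : ℕ) (j : Fin (Δ - 2)), ∃ S : Finset (Fin (Δ - 2) ⊕ Fin 1), Sum.inl j ∈ S ∧
      ((j : ℕ) + 1 = Δ - 2 → S = Finset.univ) ∧
      ((j : ℕ) + 1 ≠ Δ - 2 → 2 ≤ d → d ≤ Δ → S.card + 1 = d) := by
    intro d j
    by_cases hj : (j : ℕ) + 1 = Δ - 2
    · exact ⟨Finset.univ, Finset.mem_univ _, fun _ => rfl, fun h => absurd hj h⟩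
    by_cases hd : 2 ≤ d ∧ d ≤ Δ
    · obtain ⟨S, hS, -, hcard⟩ := Finset.exists_subsuperset_card_eq (n := d - 1)
        (Finset.subset_univ ({Sum.inl j} : Finset (Fin (Δ - 2) ⊕ Fin 1)))
        (by simp; omega) (by rw [Finset.card_univ, hY]; omega)
      exact ⟨S, hS (Finset.mem_singleton_self _), fun h => absurd h hj, fun _ _ _ => by omega⟩
    · exact ⟨{Sum.inl j}, Finset.mem_singleton_self _, fun h => absurd h hj,
        fun _ h1 h2 => absurd ⟨h1, h2⟩ hd⟩
  choose gate h1 h2 h3 using key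
  exact ⟨{
    hub := fun _ => Finset.univ
    gate := gate
    two_le_length := by omega
    mem_hub := fun _ => Finset.mem_univ _
    mem_gate := h1
    two_le_card_hub := fun _ => by rw [Finset.card_univ, hY]; omega
    card_hub_le := fun _ => by rw [Finset.card_univ, hY]; omega
    card_gate := fun d hd hd' j hj => h3 d j hj hd hd'
    card_gate_last := fun d j hj => by rw [h2 d j hj, Finset.card_univ, hY]; omega
    card_leaf_le := fun d _ z => (Finset.card_le_univ _).trans (by rw [hY]; omega)
    two_le_card_leaf := fun d _ z => by
      -- Every leaf is adjacent to the last gate, which has index Δ - 3, and to the hub.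
      have : ({Sum.inl ⟨Δ - 3, by omega⟩, Sum.inr 0} : Finset (Fin (Δ - 2) ⊕ Fin 1)).card = 2 :=
        Finset.card_pair (by simp)
      refine this.symm.le.trans (Finset.card_le_card fun x hx => ?_)
      rw [Finset.mem_insert, Finset.mem_singleton] at hx
      rcases hx with rfl | rfl
      · have hlast : (Δ - 3) + 1 = Δ - 2 := by omega
        simp [h2 _ ⟨Δ - 3, _⟩ hlast, hlast]
      · simp }⟩

/-- The leaves of the hubs for maximum degree three. -/
def hubThree (k : Fin 2) : Finset (Fin 2 ⊕ Fin 2) :=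
  if k = 0 then {.inr 0, .inr 1, .inl 0} else {.inr 1, .inl 1, .inl 0}

/-- The leaves of the gates for maximum degree three; the first gate has one or two of them. -/
def gateThree (b : Bool) (j : Fin 2) : Finset (Fin 2 ⊕ Fin 2) :=
  if j = 0 then if b then {.inl 0} else {.inl 0, .inr 0} else {.inl 1, .inr 0}

/-- Two hubs and two gates for maximum degree three. -/
def ofThree : Gadget 3 2 2 where
  hub := hubThree
  gate d := gateThree (decide (d = 2))
  two_le_length := le_rfl
  mem_hub := by decide
  mem_gate d := (by decide : ∀ b j, Sum.inl j ∈ gateThree b j) _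
  two_le_card_hub := by decide
  card_hub_le := by decide
  card_gate d h1 h2 := by
    interval_cases d <;> decide
  card_gate_last d := (by decide : ∀ b, ∀ j : Fin 2, (j : ℕ) + 1 = 2 →
    (gateThree b j).card + 1 = 3) _
  card_leaf_le d _ := (by decide : ∀ (b : Fin 2 → Bool) z, (Finset.univ.filter fun x =>
    z ∈ Sum.elim (fun j => gateThree (b j) j) hubThree x).card ≤ 3) fun j => decide (d j = 2)
  two_le_card_leaf d _ := (by decide : ∀ (b : Fin 2 → Bool) z, 2 ≤ (Finset.univ.filter fun x =>
    z ∈ Sum.elim (fun j => gateThree (b j) j) hubThree x ∧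
      ∀ j : Fin 2, x = Sum.inl j → (j : ℕ) + 1 = 2).card) fun j => decide (d j = 2)

/-- The ratio needs Δ - 2 gates per hub. A single hub then gives the required two gates only for Δ ≥
4, so Δ = 3 takes two hubs. -/
theorem exists_length_eq (hΔ : 3 ≤ Δ) :
    ∃ ℓ κ, 0 < κ ∧ ℓ = κ * (Δ - 2) ∧ Nonempty (Gadget Δ ℓ κ) := by
  rcases hΔ.eq_or_lt with rfl | hΔ
  · exact ⟨2, 2, by omega, rfl, ⟨ofThree⟩⟩
  · exact ⟨Δ - 2, 1, by omega, (one_mul _).symm, exists_of_four_le hΔ⟩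

end Gadget

end DegreeSensitive

/-! ### The approximation ratio -/

open DegreeSensitive in
theorem theorem2 (Δ : ℕ) (hΔ : 2 ≤ Δ) (A : DegreeSensitiveAlgorithm) (ε : ℝ) (hε : 0 < ε) :
    ∃ (n : ℕ) (G : SimpleGraph (Fin n)),
      G.IsBipartite ∧
      (∀ v, (G.neighborSet v).ncard ≤ Δ) ∧
      (∃ v, (G.neighborSet v).ncard = Δ) ∧
      (∃ M : G.Subgraph, M.IsPerfectMatching) ∧
      ((DegreeSensitive.output A G).card : ℝ) ≤
        ((Δ : ℝ) / (2 * (Δ : ℝ) - 2) + ε) * (DegreeSensitive.optimum G : ℝ) := by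
  rcases hΔ.eq_or_lt with rfl | hΔ
  · obtain ⟨n, G, h1, h2, h3, h4, h5, h6⟩ := exists_of_max_degree_two A
    refine ⟨n, G, h1, h2, h3, h4, ?_⟩
    have h7 : ((output A G).card : ℝ) ≤ optimum G := by exact_mod_cast h5.trans h6
    have h8 : (0 : ℝ) ≤ optimum G := Nat.cast_nonneg _
    push_cast
    nlinarith
  · obtain ⟨ℓ, κ, hκ, hℓ, ⟨g⟩⟩ := Gadget.exists_length_eq hΔ
    -- The bound exceeds the exact ratio by one edge, which ε times the optimum absorbs once the
    -- optimum is at least N > 1/ε. Taking N + 2 clusters per side also ensures 2 ≤ T.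
    obtain ⟨N, hN⟩ := exists_nat_gt (1 / ε)
    obtain ⟨n, G, h1, h2, h3, h4, h5, h6⟩ := g.exists_card_output_le (T := N + 2) hΔ (by omega) A
    refine ⟨n, G, h1, h2, h3, h4, ?_⟩
    have hℓ0 := g.two_le_length
    have h7 : (output A G).card + (N + 2) * ℓ ≤ 2 * ((N + 2) * (ℓ + κ)) + 1 := by omega
    have hΔ' : (3 : ℝ) ≤ Δ := by exact_mod_cast hΔ
    have hκ' : (1 : ℝ) ≤ κ := by exact_mod_cast hκ
    have hℓ' : (ℓ : ℝ) = κ * (Δ - 2) := by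
      rw [hℓ, Nat.cast_mul, Nat.cast_sub (by omega)]
      norm_num
    have h7' : ((output A G).card : ℝ) + (N + 2) * ℓ ≤ 2 * ((N + 2) * (ℓ + κ)) + 1 := by
      exact_mod_cast h7
    have h6' : 2 * (((N : ℝ) + 2) * (ℓ + κ)) ≤ optimum G := by exact_mod_cast h6
    have hratio : (Δ : ℝ) / (2 * Δ - 2) * (2 * ((N + 2) * (ℓ + κ))) = (N + 2) * (κ * Δ) := by
      have : (2 * (Δ : ℝ) - 2) ≠ 0 := by linarith
      rw [hℓ']
      rw [div_mul_eq_mul_div, div_eq_iff this]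
      ring
    have hε1 : 1 ≤ ε * (2 * (((N : ℝ) + 2) * (ℓ + κ))) := by
      have h8 : 1 < ε * N := by rwa [div_lt_iff₀' hε] at hN
      have h9 : (N : ℝ) ≤ 2 * ((N + 2) * (ℓ + κ)) := by
        have : (0 : ℝ) ≤ ℓ := Nat.cast_nonneg _
        nlinarith [(Nat.cast_nonneg N : (0 : ℝ) ≤ N)]
      nlinarith
    have hpos : 0 ≤ (Δ : ℝ) / (2 * Δ - 2) + ε :=
      add_nonneg (div_nonneg (by linarith) (by linarith)) hε.le
    refine le_trans ?_ (mul_le_mul_of_nonneg_left h6' hpos)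
    rw [add_mul, hratio]
    rw [hℓ'] at h7' hε1 ⊢
    linarith
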